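/- Fix a universal prefix-free machine $U$, i.e. a partial recursive function from finite binary strings to finite binary strings with prefix-free domain such that for every other prefix-free machine $M$ there is a constant $c$ with $K_U(x)\le K_M(x)+c$ for all finite strings $x$, where $K_M(x)$ denotes the least length of a program $p$ with $M(p)=x$ (and $K_M(x)=\infty$ if there is none). An infinite string $\alpha=\alpha_0\alpha_1\alpha_2\dots\in\{-1,1\}^{\omega}$ is called Kolmogorov–Chaitin complex if there is $k$ such that $K_U(\alpha_0\cdots\alpha_{n-1})\ge n-k$ for all $n$ (the two symbols being identified with the bits $0,1$). A sequence $(\varepsilon_n)_{n\ge 0}$ of signs is called an algorithmically random Rademacher sequence if it is the sequence of bits $\varepsilon_n=\alpha_n$ of some Kolmogorov–Chaitin complex $\alpha$. A sequence $(u_n)_{n\ge 0}$ of real numbers is called computable if there is a computable double sequence of rationals $(r_{n,k})$ with $|u_n-r_{n,k}|\le 2^{-k}$ for all $n,k$. Theorem. Let $(u_n)$ be a computable sequence of real numbers such that $\sum_n u_n^2=\infty$. Then for every algorithmically random Rademacher sequence $(\varepsilon_n)$ the series $\sum_n \varepsilon_n u_n$ diverges, i.e. its partial sums do not converge to a real number.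 -/

import Mathlib

open Filter Topology

namespace AlgRandom

/-! Binary strings are lists of `Bool`, and infinite binary strings are functions `ℕ → Bool`;
the bit `true` stands for `1` and the bit `false` stands for `-1`. -/

/-- A prefix-free machine: a partial recursive function from programs (binary strings) to binary
strings such that no program in its domain is a proper prefix of another one. -/
structure IsPrefixFreeMachine (M : List Bool →. List Bool) : Prop where
  partrec : Partrec M
  prefixFree : ∀ p q : List Bool, (M p).Dom → (M q).Dom → p <+: q → p = q

/-- The (prefix-free) Kolmogorov complexity of the binary string `x` with respect to the
machine `M`: the least length of a program that makes `M` output `x` (`⊤` if there is none). -/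
noncomputable def complexity (M : List Bool →. List Bool) (x : List Bool) : ℕ∞ :=
  ⨅ p : List Bool, ⨅ _ : x ∈ M p, (p.length : ℕ∞)

/-- A universal (optimal) prefix-free machine: up to an additive constant, its complexity is
minimal among those of all prefix-free machines. -/
structure IsUniversal (U : List Bool →. List Bool) : Prop where
  machine : IsPrefixFreeMachine U
  optimal : ∀ M : List Bool →. List Bool, IsPrefixFreeMachine M →
    ∃ c : ℕ, ∀ x : List Bool, complexity U x ≤ complexity M x + c

/-- The initial segment `α₀ α₁ … αₙ₋₁` of length `n`. -/
def initSeg (α : ℕ → Bool) (n : ℕ) : List Bool := (List.range n).map α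

/-- The set of Kolmogorov–Chaitin complex strings, complexity being taken with respect to `U`:
there is `k` such that `K (α₀ … αₙ₋₁) ≥ n - k` for all `n`. -/
def KC (U : List Bool →. List Bool) : Set (ℕ → Bool) :=
  {α | ∃ k : ℕ, ∀ n : ℕ, (n : ℕ∞) ≤ complexity U (initSeg α n) + k}

/-- The value `1` or `-1` of a bit. -/
def bitValue (b : Bool) : ℝ := if b then 1 else -1

/-- `ε` is an algorithmically random Rademacher sequence: the sequence of the bits of a
Kolmogorov–Chaitin complex string. -/
def IsRandomRademacher (U : List Bool →. List Bool) (ε : ℕ → ℝ) : Prop :=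
  ∃ α ∈ KC U, ∀ n, ε n = bitValue (α n)

/-- A computable sequence of real numbers: there is a computable double sequence of rationals
`(-1) ^ s n k * a n k / b n k` which approximates `u n` to within `2 ^ (-k)`. -/
def IsComputableSeq (u : ℕ → ℝ) : Prop :=
  ∃ s a b : ℕ → ℕ → ℕ, Computable₂ s ∧ Computable₂ a ∧ Computable₂ b ∧ (∀ n k, b n k ≠ 0) ∧
    ∀ n k, |u n - (-1) ^ s n k * (a n k : ℝ) / (b n k : ℝ)| ≤ 1 / 2 ^ k

section Existence

open Nat.Partrec (Code)
open Encodable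

/-- At stage `y.2` the input `n`, read as a program, halts on the code `y.1.1` and is comparable
with, and different from, the program `y.1.2`. -/
def clash (n : ℕ) (y : (Code × List Bool) × ℕ) : Prop :=
  (Code.evaln y.2 y.1.1 n).isSome = true ∧ ((decode (α := List Bool) n).getD [] ≠ y.1.2 ∧
    (y.1.2.take ((decode (α := List Bool) n).getD []).length = (decode (α := List Bool) n).getD [] ∨
     ((decode (α := List Bool) n).getD []).take y.1.2.length = y.1.2))

theorem clash_primrec : PrimrecRel clash := by
  have hq : Primrec fun z : ℕ × ((Code × List Bool) × ℕ) =>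
      (decode (α := List Bool) z.1).getD [] :=
    Primrec.option_getD.comp (Primrec.decode.comp Primrec.fst) (Primrec.const [])
  have hp : Primrec fun z : ℕ × ((Code × List Bool) × ℕ) => z.2.1.2 :=
    Primrec.snd.comp (Primrec.fst.comp Primrec.snd)
  have he : Primrec fun z : ℕ × ((Code × List Bool) × ℕ) => (Code.evaln z.2.2 z.2.1.1 z.1).isSome :=
    Primrec.option_isSome.comp (Code.primrec_evaln.comp
      (((Primrec.snd.comp Primrec.snd).pair
        (Primrec.fst.comp (Primrec.fst.comp Primrec.snd))).pair Primrec.fst))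
  refine PrimrecPred.and (Primrec.eq.comp he (Primrec.const true))
    (PrimrecPred.and (PrimrecPred.not (Primrec.eq.comp hq hp)) (PrimrecPred.or ?_ ?_))
  · exact Primrec.eq.comp (Primrec.list_take.comp (Primrec.list_length.comp hq) hp) hq
  · exact Primrec.eq.comp (Primrec.list_take.comp (Primrec.list_length.comp hp) hq) hp

open Classical in
/-- The program `p` run on the code `c`, kept only if no other comparable program halts by the
time at which `p` does. -/
noncomputable def run (c : Code) (p : List Bool) : Part (List Bool) :=
  (Nat.rfind fun t => Part.some (Code.evaln t c (encode p)).isSome).bind fun t =>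
    ((if ∃ n < t, clash n ((c, p), t) then none
      else (Code.evaln t c (encode p)).bind decode : Option (List Bool)) : Part (List Bool))

theorem run_partrec : Partrec fun y : Code × List Bool => run y.1 y.2 := by
  classical
  have he : Primrec fun z : (Code × List Bool) × ℕ => Code.evaln z.2 z.1.1 (encode z.1.2) :=
    Code.primrec_evaln.comp ((Primrec.snd.pair (Primrec.fst.comp Primrec.fst)).pair
      (Primrec.encode.comp (Primrec.snd.comp Primrec.fst)))
  refine Partrec.bind (Partrec.rfind ?_) (Computable.ofOption (Primrec.to_comp ?_))
  · exact (Primrec.option_isSome.comp he).to_comp.partrec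
  · refine Primrec.ite ?_ (Primrec.const none) (Primrec.option_bind he
      (Primrec.decode.comp Primrec.snd))
    have h := PrimrecRel.exists_mem_list clash_primrec
    exact (h.comp (Primrec.list_range.comp (Primrec.snd (α := Code × List Bool) (β := ℕ)))
      (Primrec.id (α := (Code × List Bool) × ℕ))).of_eq fun z => by simp

theorem mem_run {c : Code} {p x : List Bool} (h : x ∈ run c p) :
    ∃ t, (Code.evaln t c (encode p)).isSome ∧ (∀ n < t, ¬ clash n ((c, p), t)) ∧
      x ∈ (Code.evaln t c (encode p)).bind decode := by
  classical
  obtain ⟨t, ht, hx⟩ := Part.mem_bind_iff.1 h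
  have h1 := Nat.rfind_spec ht
  refine ⟨t, by simpa using Part.mem_some_iff.1 h1, ?_⟩
  split_ifs at hx with hc
  · simp at hx
  · push Not at hc
    exact ⟨hc, by simpa using hx⟩

theorem run_prefixFree {c : Code} {p q : List Bool} (hp : (run c p).Dom)
    (hq : (run c q).Dom) (hpq : p <+: q) : p = q := by
  by_contra hne
  obtain ⟨x, hx⟩ := Part.dom_iff_mem.1 hp
  obtain ⟨y, hy⟩ := Part.dom_iff_mem.1 hq
  obtain ⟨s, hs, hsc, -⟩ := mem_run hx
  obtain ⟨t, ht, htc, -⟩ := mem_run hy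
  obtain ⟨a, ha⟩ := Option.isSome_iff_exists.1 hs
  obtain ⟨b, hb⟩ := Option.isSome_iff_exists.1 ht
  have htake : q.take p.length = p := (List.prefix_iff_eq_take.1 hpq).symm
  rcases le_total s t with hst | hst
  · have hm := Code.evaln_mono hst ha
    refine htc _ (Code.evaln_bound hm) ⟨Option.isSome_iff_exists.2 ⟨a, hm⟩, ?_⟩
    simpa [encodek] using ⟨hne, Or.inl htake⟩
  · have hm := Code.evaln_mono hst hb
    refine hsc _ (Code.evaln_bound hm) ⟨Option.isSome_iff_exists.2 ⟨b, hm⟩, ?_⟩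
    simpa [encodek] using ⟨fun h => hne h.symm, Or.inr htake⟩

theorem exists_code_run {M : List Bool →. List Bool} (hM : IsPrefixFreeMachine M) :
    ∃ c : Code, ∀ p x, x ∈ M p → x ∈ run c p := by
  classical
  obtain ⟨c, hc⟩ := Code.exists_code.1 hM.partrec
  have hdec : ∀ n a, a ∈ Code.eval c n → ∃ p, decode (α := List Bool) n = some p ∧
      ∃ x ∈ M p, encode x = a := by
    intro n a ha
    rw [hc] at ha
    simpa using ha
  refine ⟨c, fun p x hx => ?_⟩
  have hev : encode x ∈ Code.eval c (encode p) := by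
    rw [hc]; simpa [encodek] using hx
  obtain ⟨k, hk⟩ := Code.evaln_complete.1 hev
  have hdom : (Nat.rfind fun t => Part.some (Code.evaln t c (encode p)).isSome).Dom :=
    Nat.rfind_dom.2 ⟨k, by simpa using (Option.isSome_iff_exists.2 ⟨_, hk⟩).symm, by simp⟩
  obtain ⟨t, ht⟩ := Part.dom_iff_mem.1 hdom
  have hts : (Code.evaln t c (encode p)).isSome = true := by
    simpa using Part.mem_some_iff.1 (Nat.rfind_spec ht)
  obtain ⟨a, ha⟩ := Option.isSome_iff_exists.1 hts
  have hax : a = encode x := Part.mem_unique (Code.evaln_sound ha) hev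
  refine Part.mem_bind_iff.2 ⟨t, ht, ?_⟩
  rw [if_neg]
  · rw [ha, hax]; simp [encodek]
  · rintro ⟨n, -, hn, hne, hcomp⟩
    obtain ⟨b, hb⟩ := Option.isSome_iff_exists.1 hn
    obtain ⟨q, hq, y, hy, -⟩ := hdec n b (Code.evaln_sound hb)
    simp only [hq, Option.getD_some] at hne hcomp
    have hpd := Part.dom_iff_mem.2 ⟨_, hx⟩
    have hqd := Part.dom_iff_mem.2 ⟨_, hy⟩
    rcases hcomp with h | h
    · exact hne (hM.prefixFree _ _ hqd hpd (List.prefix_iff_eq_take.2 h.symm))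
    · exact hne (hM.prefixFree _ _ hpd hqd (List.prefix_iff_eq_take.2 h.symm)).symm

/-- Universal prefix-free machines exist. -/
theorem exists_isUniversal : ∃ U : List Bool →. List Bool, IsUniversal U := by
  classical
  let hd : List Bool → ℕ := fun σ => σ.findIdx id
  let g : List Bool → Option (Code × List Bool) := fun σ =>
    if hd σ < σ.length then some (Denumerable.ofNat Code (hd σ), σ.drop (hd σ + 1)) else none
  have hhd : Primrec hd := Primrec.list_findIdx Primrec.id (Primrec.id.comp Primrec.snd)
  have hg : Primrec g := Primrec.ite (Primrec.nat_lt.comp hhd Primrec.list_length)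
    (Primrec.option_some.comp (((Primrec.ofNat Code).comp hhd).pair
      (Primrec.list_drop.comp (Primrec.succ.comp hhd) Primrec.id))) (Primrec.const none)
  have hcase : ∀ σ, (g σ = none) ∨ ∃ e p, σ = List.replicate e false ++ true :: p := by
    intro σ
    by_cases h : hd σ < σ.length
    · right
      refine ⟨hd σ, σ.drop (hd σ + 1), ?_⟩
      have h1 : σ[hd σ] = true := List.findIdx_getElem (p := id) (w := h)
      have h2 : σ.take (hd σ) = List.replicate (hd σ) false := by
        refine List.eq_replicate_iff.2 ⟨by simp; omega, fun b hb => ?_⟩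
        obtain ⟨i, hi, rfl⟩ := List.mem_iff_getElem.1 hb
        have hi' : i < hd σ := by simp at hi; omega
        have := List.not_of_lt_findIdx hi'
        simpa using this
      rw [← h2, ← h1, List.getElem_cons_drop, List.take_append_drop]
    · left; simp [g, h]
  have hgv : ∀ e p, g (List.replicate e false ++ true :: p) =
      some (Denumerable.ofNat Code e, p) := by
    intro e p
    have h : hd (List.replicate e false ++ true :: p) = e := by
      induction e with
      | zero => simp [hd, List.findIdx_cons]
      | succ k ih => simpa [hd, List.replicate_succ, List.findIdx_cons] using ih
    simp [g, h, List.drop_append]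
  let U : List Bool →. List Bool := fun σ =>
    (g σ : Part (Code × List Bool)).bind fun y => run y.1 y.2
  have hUv : ∀ e p, U (List.replicate e false ++ true :: p) =
      run (Denumerable.ofNat Code e) p := by
    intro e p
    simp [U, hgv]
  refine ⟨U, ⟨?_, ?_⟩, ?_⟩
  · exact (Computable.ofOption hg.to_comp).bind (run_partrec.comp Computable.snd)
  · intro σ τ hσ hτ hστ
    have hnone : ∀ ρ, g ρ = none → ¬ (U ρ).Dom := by intro ρ h; simp [U, h]
    obtain ⟨e, p, rfl⟩ := (hcase σ).resolve_left fun h => hnone _ h hσ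
    obtain ⟨f, q, rfl⟩ := (hcase τ).resolve_left fun h => hnone _ h hτ
    have hef : e = f ∧ p <+: q := by
      clear hσ hτ
      induction e generalizing f with
      | zero => cases f <;> simp_all [List.replicate_succ]
      | succ k ih =>
        cases f with
        | zero => simp [List.replicate_succ] at hστ
        | succ m =>
          have := ih m (by simpa [List.replicate_succ] using hστ)
          exact ⟨by omega, this.2⟩
    obtain ⟨rfl, hpq⟩ := hef
    rw [hUv] at hσ hτ
    rw [run_prefixFree hσ hτ hpq]
  · intro M hM
    obtain ⟨c, hc⟩ := exists_code_run hM
    refine ⟨encode c + 1, fun x => ?_⟩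
    have hle : ∀ q, x ∈ U q → complexity U x ≤ (q.length : ℕ∞) := fun q hq => iInf₂_le q hq
    rw [complexity.eq_1 M, ENat.iInf_add]
    refine le_iInf fun p => ?_
    by_cases hp : x ∈ M p
    · have hx : x ∈ U (List.replicate (encode c) false ++ true :: p) := by
        rw [hUv, Denumerable.ofNat_encode]; exact hc p x hp
      refine (hle _ hx).trans ?_
      simp only [hp, iInf_pos]
      norm_cast
      simp
      omega
    · simp [hp]

end Existence

end AlgRandom

/-! A convergent series has bounded partial sums, so it suffices to show that a
Kolmogorov–Chaitin complex sequence of signs cannot keep the partial sums of `∑ εₙ uₙ` in a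
bounded interval. Replacing `uₙ` by its rational approximation `vₙ` within `2 ^ (-n)` changes the
partial sums and `∑ uₙ ^ 2` only by bounded amounts, up to a factor, so the `uₙ` may be taken to
be rationals.

Let `A n` be the computable list of sign strings of length `n` all of whose partial sums lie in
`[-C, C]`. The proportion of survivors `|A n| / 2 ^ n` tends to `0`
(`length_survivors_mul_le`): when both continuations of a survivor with partial sum `S` are
considered, the average of `S ^ 2` grows by `vₙ ^ 2`, while it can never exceed `(3 C) ^ 2`, since
the terms are at most `2 C` in absolute value. Hence `|A n| * ∑_{i < n} vᵢ ^ 2 ≤ 9 C ^ 2 * 2 ^ n`.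

A sequence all of whose initial segments lie in computable lists of vanishing density is
compressible (`notMem_KC_of_sparse`). For each `j` search for a length `n` with
`|A n| * 4 ^ j ≤ 2 ^ n`; then the position of a string in `A n` can be written with exactly
`n - 2 j` bits, and preceding them with `j` ones and a zero gives a self-delimiting program of length
`n - j + 1`. -/

namespace AlgRandom

/-! ### Sequences in sparse computable sets are compressible -/

/-- The number whose binary digits, least significant first, are the bits of the string. -/
def binVal (w : List Bool) : ℕ := w.foldr (fun b v => b.toNat + 2 * v) 0

theorem primrec_binVal : Primrec binVal :=
  Primrec.list_foldr Primrec.id (Primrec.const 0)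
    (Primrec.nat_add.comp ((Primrec.dom_finite Bool.toNat).comp (Primrec.fst.comp Primrec.snd))
      (Primrec.nat_mul.comp (Primrec.const 2) (Primrec.snd.comp Primrec.snd))).to₂

theorem exists_binVal_eq (l i : ℕ) (h : i < 2 ^ l) :
    ∃ w : List Bool, w.length = l ∧ binVal w = i := by
  induction l generalizing i with
  | zero => exact ⟨[], rfl, by simp [binVal]; omega⟩
  | succ l ih =>
    obtain ⟨w, hw, hv⟩ := ih (i / 2) (by rw [pow_succ] at h; omega)
    refine ⟨decide (i % 2 = 1) :: w, by simp [hw], ?_⟩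
    have : binVal (decide (i % 2 = 1) :: w) = (decide (i % 2 = 1)).toNat + 2 * binVal w := rfl
    rw [this, hv]
    rcases Nat.mod_two_eq_zero_or_one i with h2 | h2 <;> simp [h2] <;> omega

theorem primrec_pow : Primrec₂ ((· ^ ·) : ℕ → ℕ → ℕ) :=
  Primrec₂.unpaired'.1 Nat.Primrec.pow

/-- The least length `n` at which the list `L n` has density at most `4 ^ (-j)`. -/
def sparseLevel (L : ℕ → List (List Bool)) (j : ℕ) : Part ℕ :=
  Nat.rfind fun n => Part.some (decide ((L n).length * 4 ^ j ≤ 2 ^ n))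

/-- The machine reading programs `1 ^ j 0 w`: it finds a length `n` at which `L n` has density at
most `4 ^ (-j)` and, if `w` has length `n - 2 j`, outputs the entry of `L n` whose position is
written in binary in `w`. -/
def sparseMachine (L : ℕ → List (List Bool)) : List Bool →. List Bool := fun p =>
  (sparseLevel L (p.findIdx not)).bind fun n =>
    ((if p.findIdx not < p.length ∧ (p.drop (p.findIdx not + 1)).length + 2 * p.findIdx not = n
      then (L n)[binVal (p.drop (p.findIdx not + 1))]? else none : Option (List Bool)) :
      Part (List Bool))

theorem sparseMachine_partrec {L : ℕ → List (List Bool)} (hL : Computable L) :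
    Partrec (sparseMachine L) := by
  have hj : Primrec fun p : List Bool => p.findIdx not :=
    Primrec.list_findIdx Primrec.id (Primrec.not.comp Primrec.snd).to₂
  have hw : Primrec fun p : List Bool => p.drop (p.findIdx not + 1) :=
    Primrec.list_drop.comp (Primrec.succ.comp hj) Primrec.id
  have hdec : Primrec fun z : List (List Bool) × (ℕ × ℕ) =>
      decide (z.1.length * 4 ^ z.2.1 ≤ 2 ^ z.2.2) :=
    (Primrec.nat_le.comp
      (Primrec.nat_mul.comp (Primrec.list_length.comp Primrec.fst)
        (primrec_pow.comp (Primrec.const 4) (Primrec.fst.comp Primrec.snd)))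
      (primrec_pow.comp (Primrec.const 2) (Primrec.snd.comp Primrec.snd))).decide
  have hlevel : Partrec (sparseLevel L) := by
    refine Partrec.rfind ?_
    exact (hdec.to_comp.comp ((hL.comp Computable.snd).pair
      (Computable.fst.pair Computable.snd))).partrec
  have hout : Primrec fun z : List (List Bool) × (List Bool × ℕ) =>
      (if z.2.1.findIdx not < z.2.1.length ∧
          (z.2.1.drop (z.2.1.findIdx not + 1)).length + 2 * z.2.1.findIdx not = z.2.2
        then z.1[binVal (z.2.1.drop (z.2.1.findIdx not + 1))]? else none : Option (List Bool)) := by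
    have hp : Primrec fun z : List (List Bool) × (List Bool × ℕ) => z.2.1 :=
      Primrec.fst.comp Primrec.snd
    refine Primrec.ite (PrimrecPred.and
      (Primrec.nat_lt.comp (hj.comp hp) (Primrec.list_length.comp hp))
      (Primrec.eq.comp (Primrec.nat_add.comp (Primrec.list_length.comp (hw.comp hp))
        (Primrec.nat_mul.comp (Primrec.const 2) (hj.comp hp)))
        (Primrec.snd.comp Primrec.snd)))
      (Primrec.list_getElem?.comp Primrec.fst (primrec_binVal.comp (hw.comp hp)))
      (Primrec.const none)
  refine Partrec.bind (hlevel.comp hj.to_comp) (Computable.ofOption ?_)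
  exact hout.to_comp.comp ((hL.comp Computable.snd).pair
    (Computable.fst.pair Computable.snd))

theorem mem_sparseMachine {L : ℕ → List (List Bool)} {p x : List Bool} :
    x ∈ sparseMachine L p ↔ ∃ n ∈ sparseLevel L (p.findIdx not),
      (p.findIdx not < p.length ∧
        (p.drop (p.findIdx not + 1)).length + 2 * p.findIdx not = n) ∧
      (L n)[binVal (p.drop (p.findIdx not + 1))]? = some x := by
  unfold sparseMachine
  rw [Part.mem_bind_iff]
  refine exists_congr fun n => and_congr_right fun _ => ?_
  split_ifs with h
  · rw [Part.mem_coe, Option.mem_def]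
    exact ⟨fun hx => ⟨h, hx⟩, And.right⟩
  · exact ⟨fun hx => by simp at hx, fun hx => absurd hx.1 h⟩

/-- Comparable programs in the domain have the same header `1 ^ j 0`, which determines `n` and
hence the length `n - j + 1` of the whole program. -/
theorem sparseMachine_isPrefixFree {L : ℕ → List (List Bool)} (hL : Computable L) :
    IsPrefixFreeMachine (sparseMachine L) := by
  refine ⟨sparseMachine_partrec hL, fun p q hp hq hpq => ?_⟩
  obtain ⟨x, hx⟩ := Part.dom_iff_mem.1 hp
  obtain ⟨y, hy⟩ := Part.dom_iff_mem.1 hq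
  obtain ⟨n, hn, ⟨hlt, hlen⟩, -⟩ := mem_sparseMachine.1 hx
  obtain ⟨m, hm, ⟨hlt', hlen'⟩, -⟩ := mem_sparseMachine.1 hy
  obtain ⟨r, rfl⟩ := hpq
  have hj : (p ++ r).findIdx not = p.findIdx not := by
    rw [List.findIdx_append, if_pos hlt]
  rw [hj] at hm hlt' hlen'
  obtain rfl := Part.mem_unique hn hm
  rw [List.length_drop] at hlen hlen'
  have : r.length = 0 := by
    rw [List.length_append] at hlen'
    omega
  simp [List.length_eq_zero_iff.1 this]

theorem findIdx_not_replicate (j : ℕ) (w : List Bool) :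
    (List.replicate j true ++ false :: w).findIdx not = j := by
  induction j with
  | zero => simp [List.findIdx_cons]
  | succ k ih => simpa [List.replicate_succ, List.findIdx_cons] using ih

theorem exists_complexity_sparseMachine_le {L : ℕ → List (List Bool)} {α : ℕ → Bool}
    (hα : ∀ n, initSeg α n ∈ L n) (hsparse : ∀ j, ∃ n, (L n).length * 4 ^ j ≤ 2 ^ n) (j : ℕ) :
    ∃ n m : ℕ, m + j = n + 1 ∧ complexity (sparseMachine L) (initSeg α n) ≤ m := by
  obtain ⟨n₀, hn₀⟩ := hsparse j
  have hdom : (sparseLevel L j).Dom :=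
    Nat.rfind_dom.2 ⟨n₀, by simpa using hn₀, by simp⟩
  obtain ⟨n, hn⟩ := Part.dom_iff_mem.1 hdom
  have hle : (L n).length * 4 ^ j ≤ 2 ^ n := by
    simpa using Part.mem_some_iff.1 (Nat.rfind_spec hn)
  obtain ⟨i, hi, hix⟩ := List.mem_iff_getElem.1 (hα n)
  have h4 : (4 : ℕ) ^ j = 2 ^ (2 * j) := by rw [pow_mul]; norm_num
  have hjn : 2 * j ≤ n := by
    refine (Nat.pow_le_pow_iff_right (a := 2) (by norm_num)).1 ?_
    rw [← h4]
    exact (Nat.le_mul_of_pos_left _ (by omega)).trans hle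
  -- the density bound says that the position `i` fits into `n - 2 j` bits
  obtain ⟨w, hw, hv⟩ := exists_binVal_eq (n - 2 * j) i (by
    refine hi.trans_le (Nat.le_of_mul_le_mul_right ?_ (pow_pos (by norm_num : 0 < 4) j))
    rwa [h4, ← pow_add, Nat.sub_add_cancel hjn, ← h4])
  refine ⟨n, n - j + 1, by omega, ?_⟩
  have hdrop : (List.replicate j true ++ false :: w).drop (j + 1) = w := by
    simp [List.drop_append]
  have hmem : initSeg α n ∈ sparseMachine L (List.replicate j true ++ false :: w) := by
    refine mem_sparseMachine.2 ⟨n, ?_⟩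
    rw [findIdx_not_replicate, hdrop]
    refine ⟨hn, ⟨by simp, by omega⟩, ?_⟩
    rw [hv, List.getElem?_eq_getElem hi, hix]
  refine (iInf₂_le (f := fun (p : List Bool) (_ : _ ∈ sparseMachine L p) => (p.length : ℕ∞))
    _ hmem).trans ?_
  norm_cast
  simp [hw]
  omega

/-- A sequence whose initial segments lie in a computable sequence of lists of vanishing density
is not Kolmogorov–Chaitin complex. -/
theorem notMem_KC_of_sparse {U : List Bool →. List Bool} (hU : IsUniversal U)
    {L : ℕ → List (List Bool)} (hL : Computable L) {α : ℕ → Bool} (hα : ∀ n, initSeg α n ∈ L n)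
    (hsparse : ∀ j, ∃ n, (L n).length * 4 ^ j ≤ 2 ^ n) : α ∉ KC U := by
  rintro ⟨k, hk⟩
  obtain ⟨c, hc⟩ := hU.optimal _ (sparseMachine_isPrefixFree hL)
  obtain ⟨n, m, hm, hcomp⟩ := exists_complexity_sparseMachine_le hα hsparse (k + c + 2)
  have h : (n : ℕ∞) ≤ ((m + c + k : ℕ) : ℕ∞) := by
    push_cast
    refine (hk n).trans ?_
    gcongr
    refine (hc _).trans ?_
    gcongr
  have := Nat.cast_le.1 h
  omega

/-! ### Sign strings with bounded partial sums -/

/-- The rational number `(-1) ^ s * a / b` coded by `(s, a, b)`. -/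
noncomputable def ratVal (t : ℕ × ℕ × ℕ) : ℝ := (-1) ^ t.1 * (t.2.1 : ℝ) / (t.2.2 : ℝ)

/-- A sign string together with its partial sum, the latter coded by `(P, Q, D)` standing for
`(P - Q) / D`. -/
abbrev Node : Type := List Bool × ℕ × ℕ × ℕ

/-- The partial sum recorded in a node. -/
noncomputable def Node.val (σ : Node) : ℝ := ((σ.2.1 : ℝ) - σ.2.2.1) / σ.2.2.2

/-- The node obtained by appending the sign `b` and adding the term `b * ratVal t`. -/
def extend (b : Bool) (t : ℕ × ℕ × ℕ) (σ : Node) : Node :=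
  (σ.1 ++ [b],
    if decide (t.1 % 2 = 0) = b then
      (σ.2.1 * t.2.2 + t.2.1 * σ.2.2.2, σ.2.2.1 * t.2.2, σ.2.2.2 * t.2.2)
    else (σ.2.1 * t.2.2, σ.2.2.1 * t.2.2 + t.2.1 * σ.2.2.2, σ.2.2.2 * t.2.2))

/-- The partial sum recorded in the node lies in `[-C, C]`, with denominators cleared. -/
def InBand (C : ℕ) (σ : Node) : Prop :=
  σ.2.1 ≤ σ.2.2.1 + C * σ.2.2.2 ∧ σ.2.2.1 ≤ σ.2.1 + C * σ.2.2.2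

instance (C : ℕ) : DecidablePred (InBand C) := fun σ => by unfold InBand; infer_instance

/-- The continuations, by either sign and the term `t`, of the given nodes that stay in
`[-C, C]`. -/
def grow (C : ℕ) (t : ℕ × ℕ × ℕ) (S : List Node) : List Node :=
  (S.map (extend true t) ++ S.map (extend false t)).filter (InBand C ·)

/-- The sign strings of length `n` all of whose partial sums lie in `[-C, C]`. -/
def survivors (C : ℕ) (t : ℕ → ℕ × ℕ × ℕ) : ℕ → List Node
  | 0 => [([], 0, 0, 1)]
  | n + 1 => grow C (t n) (survivors C t n)

theorem extend_primrec (b : Bool) : Primrec₂ (extend b) := by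
  have ht : Primrec fun z : (ℕ × ℕ × ℕ) × Node => z.1 := Primrec.fst
  have hs : Primrec fun z : (ℕ × ℕ × ℕ) × Node => z.1.1 := Primrec.fst.comp ht
  have ha : Primrec fun z : (ℕ × ℕ × ℕ) × Node => z.1.2.1 :=
    Primrec.fst.comp (Primrec.snd.comp ht)
  have hb : Primrec fun z : (ℕ × ℕ × ℕ) × Node => z.1.2.2 :=
    Primrec.snd.comp (Primrec.snd.comp ht)
  have hx : Primrec fun z : (ℕ × ℕ × ℕ) × Node => z.2.1 := Primrec.fst.comp Primrec.snd
  have hPQD : Primrec fun z : (ℕ × ℕ × ℕ) × Node => z.2.2 := Primrec.snd.comp Primrec.snd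
  have hP : Primrec fun z : (ℕ × ℕ × ℕ) × Node => z.2.2.1 := Primrec.fst.comp hPQD
  have hQ : Primrec fun z : (ℕ × ℕ × ℕ) × Node => z.2.2.2.1 :=
    Primrec.fst.comp (Primrec.snd.comp hPQD)
  have hD : Primrec fun z : (ℕ × ℕ × ℕ) × Node => z.2.2.2.2 :=
    Primrec.snd.comp (Primrec.snd.comp hPQD)
  have hPb := Primrec.nat_mul.comp hP hb
  have hQb := Primrec.nat_mul.comp hQ hb
  have hDb := Primrec.nat_mul.comp hD hb
  have haD := Primrec.nat_mul.comp ha hD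
  refine Primrec.pair (Primrec.list_concat.comp hx (Primrec.const b)) (Primrec.ite
    (Primrec.eq.comp (PrimrecPred.decide (Primrec.eq.comp
      (Primrec.nat_mod.comp hs (Primrec.const 2)) (Primrec.const 0))) (Primrec.const b))
    ((Primrec.nat_add.comp hPb haD).pair (hQb.pair hDb))
    (hPb.pair ((Primrec.nat_add.comp hQb haD).pair hDb)))

theorem inBand_primrec (C : ℕ) : PrimrecPred (InBand C) := by
  have hP : Primrec fun σ : Node => σ.2.1 := Primrec.fst.comp Primrec.snd
  have hQ : Primrec fun σ : Node => σ.2.2.1 :=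
    Primrec.fst.comp (Primrec.snd.comp Primrec.snd)
  have hD : Primrec fun σ : Node => C * σ.2.2.2 :=
    Primrec.nat_mul.comp (Primrec.const C) (Primrec.snd.comp (Primrec.snd.comp Primrec.snd))
  exact PrimrecPred.and (Primrec.nat_le.comp hP (Primrec.nat_add.comp hQ hD))
    (Primrec.nat_le.comp hQ (Primrec.nat_add.comp hP hD))

theorem grow_primrec (C : ℕ) : Primrec₂ (grow C) := by
  have h (b : Bool) : Primrec fun z : (ℕ × ℕ × ℕ) × List Node => z.2.map (extend b z.1) :=
    Primrec.list_map Primrec.snd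
      ((extend_primrec b).comp (Primrec.fst.comp Primrec.fst) Primrec.snd).to₂
  exact (Primrec.listFilter (inBand_primrec C)).comp (Primrec.list_append.comp (h true) (h false))

theorem survivors_computable (C : ℕ) {t : ℕ → ℕ × ℕ × ℕ} (ht : Computable t) :
    Computable (survivors C t) := by
  have h : Computable₂ fun (_ : ℕ) (z : ℕ × List Node) => grow C (t z.1) z.2 :=
    (grow_primrec C).to_comp.comp (ht.comp (Computable.fst.comp Computable.snd))
      (Computable.snd.comp Computable.snd)
  refine (Computable.nat_rec Computable.id (Computable.const [([], 0, 0, 1)]) h).of_eq fun n => ?_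
  induction n with
  | zero => rfl
  | succ n ih => exact congrArg (grow C (t n)) ih

theorem val_extend (b : Bool) {t : ℕ × ℕ × ℕ} {σ : Node} (ht : t.2.2 ≠ 0) (hσ : σ.2.2.2 ≠ 0) :
    (extend b t σ).val = σ.val + bitValue b * ratVal t := by
  obtain ⟨s, a, d⟩ := t
  obtain ⟨x, P, Q, D⟩ := σ
  have hd : (d : ℝ) ≠ 0 := by exact_mod_cast ht
  have hD : (D : ℝ) ≠ 0 := by exact_mod_cast hσ
  rcases Nat.even_or_odd s with hs | hs <;> cases b <;>
    simp [extend, Node.val, ratVal, bitValue, hs.neg_one_pow, Nat.even_iff.1, Nat.odd_iff.1, hs] <;>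
    field_simp <;> ring

theorem denom_extend_ne_zero (b : Bool) {t : ℕ × ℕ × ℕ} {σ : Node} (ht : t.2.2 ≠ 0)
    (hσ : σ.2.2.2 ≠ 0) : (extend b t σ).2.2.2 ≠ 0 := by
  unfold extend
  split_ifs <;> exact mul_ne_zero hσ ht

theorem inBand_iff {C : ℕ} {σ : Node} (hσ : σ.2.2.2 ≠ 0) : InBand C σ ↔ |σ.val| ≤ C := by
  have hD : (0 : ℝ) < σ.2.2.2 := by exact_mod_cast Nat.pos_of_ne_zero hσ
  rw [Node.val, abs_div, abs_of_pos hD, div_le_iff₀ hD, abs_le, InBand,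
    ← Nat.cast_le (α := ℝ), ← Nat.cast_le (α := ℝ)]
  push_cast
  constructor <;> rintro ⟨h₁, h₂⟩ <;> constructor <;> linarith

theorem survivors_spec {C : ℕ} {t : ℕ → ℕ × ℕ × ℕ} (ht : ∀ n, (t n).2.2 ≠ 0) (n : ℕ) :
    ∀ σ ∈ survivors C t n, σ.2.2.2 ≠ 0 ∧ |σ.val| ≤ C := by
  induction n with
  | zero => simp [survivors, Node.val]
  | succ n ih =>
    intro σ hσ
    obtain ⟨hmem, hband⟩ := List.mem_filter.1 hσ
    have hD : σ.2.2.2 ≠ 0 := by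
      rcases List.mem_append.1 hmem with h | h <;>
        obtain ⟨τ, hτ, rfl⟩ := List.mem_map.1 h <;>
        exact denom_extend_ne_zero _ (ht n) (ih τ hτ).1
    exact ⟨hD, (inBand_iff hD).1 (by simpa using hband)⟩

theorem initSeg_mem_survivors {C : ℕ} {t : ℕ → ℕ × ℕ × ℕ} (ht : ∀ n, (t n).2.2 ≠ 0)
    {α : ℕ → Bool}
    (hα : ∀ n, |∑ i ∈ Finset.range n, bitValue (α i) * ratVal (t i)| ≤ C) (n : ℕ) :
    ∃ σ ∈ survivors C t n, σ.1 = initSeg α n ∧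
      σ.val = ∑ i ∈ Finset.range n, bitValue (α i) * ratVal (t i) := by
  induction n with
  | zero => exact ⟨_, List.mem_singleton_self _, by simp [initSeg, Node.val]⟩
  | succ n ih =>
    obtain ⟨σ, hσ, hx, hv⟩ := ih
    have hD := (survivors_spec ht n σ hσ).1
    have hval := val_extend (α n) (ht n) hD
    rw [hv, ← Finset.sum_range_succ (fun i => bitValue (α i) * ratVal (t i))] at hval
    refine ⟨extend (α n) (t n) σ, List.mem_filter.2 ⟨?_, ?_⟩, ?_, hval⟩
    · cases α n
      · exact List.mem_append_right _ (List.mem_map_of_mem hσ)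
      · exact List.mem_append_left _ (List.mem_map_of_mem hσ)
    · have : InBand C (extend (α n) (t n) σ) :=
        (inBand_iff (denom_extend_ne_zero _ (ht n) hD)).2 (hval ▸ hα (n + 1))
      simpa using this
    · simp [extend, hx, initSeg, List.range_succ]

/-! ### The survivors have vanishing density -/

theorem sum_map_filter_le {β : Type*} (p : β → Bool) (f : β → ℝ) (l : List β)
    (h : ∀ x ∈ l, 0 ≤ f x) : ((l.filter p).map f).sum ≤ (l.map f).sum := by
  refine List.Sublist.sum_le_sum ((List.filter_sublist).map f) ?_
  simpa using h

/-- The quadratic bookkeeping behind the growth of the second moment: as long as all terms are at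
most `2 C`, the quantity `(3 C) ^ 2 - S ^ 2` is nonnegative for all continuations of survivors,
and its sum over the two continuations of one survivor is `2 v ^ 2` less than twice its value.
Discarding the continuations that leave `[-C, C]` only lowers the total further. -/
theorem sum_grow_le {C : ℕ} {t : ℕ × ℕ × ℕ} (ht : t.2.2 ≠ 0) (hC : |ratVal t| ≤ 2 * C)
    {S : List Node} (hS : ∀ σ ∈ S, σ.2.2.2 ≠ 0 ∧ |σ.val| ≤ C) :
    ((grow C t S).map fun σ => 9 * (C : ℝ) ^ 2 - σ.val ^ 2).sum ≤
      2 * (S.map fun σ => 9 * (C : ℝ) ^ 2 - σ.val ^ 2).sum - 2 * S.length * ratVal t ^ 2 := by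
  refine (sum_map_filter_le _ _ _ fun σ hσ => ?_).trans (le_of_eq ?_)
  · have key : ∀ b, ∀ τ ∈ S, 0 ≤ 9 * (C : ℝ) ^ 2 - (extend b t τ).val ^ 2 := by
      intro b τ hτ
      have h1 : |(extend b t τ).val| ≤ 3 * C := by
        rw [val_extend b ht (hS τ hτ).1]
        have h2 : |bitValue b * ratVal t| = |ratVal t| := by cases b <;> simp [bitValue]
        have := abs_add_le τ.val (bitValue b * ratVal t)
        linarith [(hS τ hτ).2]
      have := sq_le_sq' (abs_le.1 h1).1 (abs_le.1 h1).2
      linarith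
    rcases List.mem_append.1 hσ with h | h <;> obtain ⟨τ, hτ, rfl⟩ := List.mem_map.1 h <;>
      exact key _ τ hτ
  · induction S with
    | nil => simp
    | cons σ S ih =>
      have ih := ih fun τ hτ => hS τ (List.mem_cons_of_mem _ hτ)
      have hσ := (hS σ List.mem_cons_self).1
      simp only [List.map_append, List.map_cons, List.sum_append, List.sum_cons, List.map_map,
        List.length_cons, val_extend _ ht hσ, bitValue, if_true, Bool.false_eq_true, if_false] at ih ⊢
      push_cast
      linarith

theorem length_grow_le (C : ℕ) (t : ℕ × ℕ × ℕ) (S : List Node) :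
    (grow C t S).length ≤ 2 * S.length := by
  refine (List.length_filter_le _ _).trans ?_
  simp
  omega

/-- The proportion of sign strings of length `n` with partial sums in `[-C, C]` is at most
`9 * C ^ 2` divided by the sum of the squares of the terms. -/
theorem length_survivors_mul_le {C : ℕ} {t : ℕ → ℕ × ℕ × ℕ} (ht : ∀ n, (t n).2.2 ≠ 0)
    (hC : ∀ n, |ratVal (t n)| ≤ 2 * C) (n : ℕ) :
    ((survivors C t n).length : ℝ) * ∑ i ∈ Finset.range n, ratVal (t i) ^ 2 ≤
      9 * (C : ℝ) ^ 2 * 2 ^ n := by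
  have key : ((survivors C t n).length : ℝ) * ∑ i ∈ Finset.range n, ratVal (t i) ^ 2 +
      ((survivors C t n).map fun σ => 9 * (C : ℝ) ^ 2 - σ.val ^ 2).sum ≤
        9 * (C : ℝ) ^ 2 * 2 ^ n := by
    induction n with
    | zero => simp [survivors, Node.val]
    | succ n ih =>
      -- the loss `2 * |A n| * vₙ ^ 2` of the second summand pays for the new term of the first
      have h1 := sum_grow_le (ht n) (hC n) (survivors_spec (C := C) ht n)
      have h2 : ((survivors C t (n + 1)).length : ℝ) ≤ 2 * (survivors C t n).length := by
        exact_mod_cast length_grow_le C (t n) (survivors C t n)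
      have h3 : 0 ≤ ∑ i ∈ Finset.range (n + 1), ratVal (t i) ^ 2 :=
        Finset.sum_nonneg fun i _ => sq_nonneg _
      have h4 := mul_le_mul_of_nonneg_right h2 h3
      rw [Finset.sum_range_succ] at h4 ⊢
      rw [pow_succ (2 : ℝ)]
      simp only [survivors] at h4 ⊢
      linarith
  have hnonneg : 0 ≤ ((survivors C t n).map fun σ => 9 * (C : ℝ) ^ 2 - σ.val ^ 2).sum := by
    refine List.sum_nonneg fun x hx => ?_
    obtain ⟨σ, hσ, rfl⟩ := List.mem_map.1 hx
    have h := (survivors_spec ht n σ hσ).2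
    have := sq_le_sq' (abs_le.1 h).1 (abs_le.1 h).2
    have := sq_nonneg (C : ℝ)
    linarith
  linarith

/-! ### Complex sign sequences have unbounded partial sums -/

theorem notMem_KC_of_bounded {U : List Bool →. List Bool} (hU : IsUniversal U)
    {t : ℕ → ℕ × ℕ × ℕ} (htc : Computable t) (ht : ∀ n, (t n).2.2 ≠ 0)
    (hdiv : Tendsto (fun N : ℕ => ∑ n ∈ Finset.range N, ratVal (t n) ^ 2) atTop atTop)
    {C : ℕ} (hC : 0 < C) {α : ℕ → Bool}
    (hα : ∀ n, |∑ i ∈ Finset.range n, bitValue (α i) * ratVal (t i)| ≤ C) : α ∉ KC U := by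
  -- each term is a difference of two partial sums of `α`
  have hterm : ∀ n, |ratVal (t n)| ≤ 2 * C := by
    intro n
    have h1 := hα (n + 1)
    rw [Finset.sum_range_succ] at h1
    have h2 : |bitValue (α n) * ratVal (t n)| = |ratVal (t n)| := by
      cases α n <;> simp [bitValue]
    rw [← h2]
    have h3 := hα n
    rw [abs_le] at h1 h3 ⊢
    constructor <;> linarith
  refine notMem_KC_of_sparse hU (L := fun n => (survivors C t n).map Prod.fst) ?_ ?_ ?_
  · exact (Primrec.list_map Primrec.id (Primrec.fst.comp Primrec.snd).to₂).to_comp.comp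
      (survivors_computable C htc)
  · intro n
    obtain ⟨σ, hσ, hx, -⟩ := initSeg_mem_survivors ht hα n
    exact List.mem_map.2 ⟨σ, hσ, hx⟩
  · intro j
    obtain ⟨n, hn⟩ := (hdiv.eventually_ge_atTop (9 * (C : ℝ) ^ 2 * 4 ^ j)).exists
    refine ⟨n, ?_⟩
    have h := (mul_le_mul_of_nonneg_left hn (Nat.cast_nonneg _)).trans
      (length_survivors_mul_le ht hterm n)
    have hpos : (0 : ℝ) < 9 * (C : ℝ) ^ 2 := by positivity
    rw [List.length_map, ← Nat.cast_le (α := ℝ)]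
    push_cast
    refine le_of_mul_le_mul_left ?_ hpos
    linarith

end AlgRandom

theorem mainTheorem5 (U : List Bool →. List Bool) (hU : AlgRandom.IsUniversal U)
    (u : ℕ → ℝ) (hu : AlgRandom.IsComputableSeq u)
    (hdiv : Tendsto (fun N : ℕ => ∑ n ∈ Finset.range N, u n ^ 2) atTop atTop)
    (ε : ℕ → ℝ) (hε : AlgRandom.IsRandomRademacher U ε) :
    ¬ ∃ l : ℝ, Tendsto (fun N : ℕ => ∑ n ∈ Finset.range N, ε n * u n) atTop (𝓝 l) := by
  rintro ⟨l, hl⟩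
  obtain ⟨α, hα, hεα⟩ := hε
  obtain ⟨s, a, b, hs, ha, hb, hb0, hu⟩ := hu
  obtain ⟨B, hB⟩ := isBounded_iff_forall_norm_le.1 (Metric.isBounded_range_of_tendsto _ hl)
  let t : ℕ → ℕ × ℕ × ℕ := fun n => (s n n, a n n, b n n)
  have htc : Computable t :=
    (hs.comp Computable.id Computable.id).pair
      ((ha.comp Computable.id Computable.id).pair (hb.comp Computable.id Computable.id))
  have hclose : ∀ n, |u n - AlgRandom.ratVal (t n)| ≤ (1 / 2 : ℝ) ^ n := fun n => by
    simpa [AlgRandom.ratVal, t] using hu n n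
  refine AlgRandom.notMem_KC_of_bounded hU htc (fun n => hb0 n n) ?_ (C := ⌈B⌉₊ + 2) (by omega)
    (fun n => ?_) hα
  · have hcmp : ∀ N, (∑ n ∈ Finset.range N, u n ^ 2 - 4) / 2 ≤
        ∑ n ∈ Finset.range N, AlgRandom.ratVal (t n) ^ 2 := by
      intro N
      have h : ∑ n ∈ Finset.range N, u n ^ 2 ≤
          ∑ n ∈ Finset.range N, (2 * AlgRandom.ratVal (t n) ^ 2 + 2 * (1 / 2 : ℝ) ^ n) := by
        refine Finset.sum_le_sum fun n _ => ?_
        -- `u ^ 2 ≤ 2 * v ^ 2 + 2 * (u - v) ^ 2`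
        have h1 := sq_le_sq' (abs_le.1 (hclose n)).1 (abs_le.1 (hclose n)).2
        have h2 : ((1 / 2 : ℝ) ^ n) ^ 2 ≤ (1 / 2 : ℝ) ^ n :=
          pow_le_of_le_one (by positivity)
            (pow_le_one₀ (by norm_num) (by norm_num)) two_ne_zero
        linarith [sq_nonneg (u n - 2 * AlgRandom.ratVal (t n))]
      rw [Finset.sum_add_distrib, ← Finset.mul_sum, ← Finset.mul_sum] at h
      linarith [sum_geometric_two_le N]
    refine tendsto_atTop_mono hcmp ?_
    exact (tendsto_atTop_add_const_right _ (-4) hdiv).atTop_div_const two_pos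
  · have h1 : |∑ i ∈ Finset.range n, ε i * u i| ≤ B := hB _ ⟨n, rfl⟩
    have h2 : |∑ i ∈ Finset.range n, ε i * u i -
        ∑ i ∈ Finset.range n, AlgRandom.bitValue (α i) * AlgRandom.ratVal (t i)| ≤ 2 := by
      rw [← Finset.sum_sub_distrib]
      refine (Finset.abs_sum_le_sum_abs _ _).trans
        ((Finset.sum_le_sum fun i _ => ?_).trans (sum_geometric_two_le n))
      rw [hεα, ← mul_sub, abs_mul]
      have : |AlgRandom.bitValue (α i)| = 1 := by cases α i <;> simp [AlgRandom.bitValue]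
      rw [this, one_mul]
      exact hclose i
    push_cast
    have := Nat.le_ceil B
    rw [abs_le] at h1 h2 ⊢
    constructor <;> linarith
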